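/- Let $\mathcal M_1=(E,\mathcal B_1)$ and $\mathcal M_2=(E,\mathcal B_2)$ be matroids on a common finite ground set $E$, given by their sets of bases, and let $c_1,c_2\colon E\to\mathbb R$. Write $c_i(Z)=\sum_{e\in Z}c_i(e)$. For $k\in\mathbb N$ let $(P_{=k})$ be the problem of minimizing $c_1(X)+c_2(Y)$ over all $X\in\mathcal B_1$, $Y\in\mathcal B_2$ with $|X\cap Y|=k$. Consider the following primal-dual algorithm. **Start.** Compute a minimizer $(X_0,Y_0)$ of $c_1(X)+c_2(Y)$ over $\mathcal B_1\times\mathcal B_2$. If $|X_0\cap Y_0|\le k$, put $\lambda=0$, $\alpha=\beta=0\in\mathbb R^E$, $(X,Y)=(X_0,Y_0)$ and enter the main loop. If $|X_0\cap Y_0|>k$, run the main loop instead with $\mathcal M_2$ replaced by its dual matroid, $c_2$ by $-c_2$, $k$ by $k^*=\operatorname{rk}(\mathcal M_1)-k$, and with initial pair $(X_0,E\setminus Y_0)$; a pair $(X,Y)$ of this loop stands for the pair $(X,E\setminus Y)$ of the original instance. **Main loop.** While $|X\cap Y|<k$: form the digraph $D$ on $E$ with a red arc $(e,f)$ whenever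 $e\notin X$, $f\in X$, $X-f+e\in\mathcal B_1$ and $c_1(e)-\alpha_e=c_1(f)-\alpha_f$, and a blue arc $(f,g)$ whenever $f\in Y$, $g\notin Y$, $Y-f+g\in\mathcal B_2$ and $c_2(g)-\beta_g=c_2(f)-\beta_f$. * *Primal augmentation.* If $D$ has a red-blue alternating path from $Y\setminus X$ to $X\setminus Y$, choose one with the fewest arcs; replace $X$ by the result of all its red moves $X\mapsto X-f+e$ and $Y$ by the result of all its blue moves $Y\mapsto Y-f+g$. * *Dual augmentation.* Otherwise let $R$ be the set of elements reachable from $Y\setminus X$ on red-blue alternating paths, and let $\delta=\min\{\delta_1,\delta_2\}$, where $\delta_1$ is the minimum of $(c_1(e)-\alpha_e)-(c_1(f)-\alpha_f)$ over $e\in R\setminus X$, $f\in X\setminus R$ with $X-f+e\in\mathcal B_1$, and $\delta_2$ is the minimum of $(c_2(g)-\beta_g)-(c_2(f)-\beta_f)$ over $g\notin Y\cup R$, $f\in Y\cap R$ with $Y-f+g\in\mathcal B_2$ (a minimum over the empty set is $\infty$). If $\delta=\infty$, stop with the message "infeasible instance". Otherwise add $\delta$ to $\lambda$, to $\alpha_e$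 for all $e\in R$, and to $\beta_e$ for all $e\notin R$. When the loop ends, return $(X,Y)$ (in the dualized case, $(X,E\setminus Y)$). **Theorem 3.5.** A starting pair $(X_0,Y_0)$ exists, and the following holds for every starting pair and every choice of the augmenting paths. 1. For every $k\in\mathbb N$ the algorithm solves $(P_{=k})$: it never gets stuck, it always terminates, a returned pair is an optimal solution of $(P_{=k})$, and if it stops with "infeasible instance" then $(P_{=k})$ has no feasible solution. It uses at most $k\cdot|E|$ primal and dual augmentations if $|X_0\cap Y_0|\le k$, and at most $k^*\cdot|E|$ with $k^*=\operatorname{rk}(\mathcal M_1)-k$ if $|X_0\cap Y_0|>k$. 2. Let $K=\min\{\operatorname{rk}(\mathcal M_1),\operatorname{rk}(\mathcal M_2)\}$. Two complete runs from the same starting pair, for $k=0$ and for $k=K$, together use at most $|E|^2$ primal and dual augmentations. Every base pair $(X,Y)$ (of the original instance) that occurs in them is an optimal solution of $(P_{=|X\cap Y|})$, and for each $k\in\{0,\dots,K\}$ for which $(P_{=k})$ is feasible such a pair with $|X\cap Y|=k$ occurs. So the two runs give optimal solutions of all the feasible problems $(P_{=k})$, $k=0,\dots,K$. -/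

import Mathlib

/-- An instance (without the parameter `k`): two matroids on the common finite ground set `E`
and two real cost functions. -/
structure BasisPairInstance (E : Type*) where
  M₁ : Matroid E
  M₂ : Matroid E
  ground₁ : M₁.E = Set.univ
  ground₂ : M₂.E = Set.univ
  c₁ : E → ℝ
  c₂ : E → ℝ

/-- The rank of a matroid on a finite ground set as a natural number:
the common cardinality of its bases. -/
noncomputable def matroidRank {E : Type*} (M : Matroid E) : ℕ := M.eRank.toNat

/-- The variables of the primal-dual algorithm. -/
structure PDState (E : Type*) where
  X : Finset E
  Y : Finset E
  lam : ℝ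
  α : E → ℝ
  β : E → ℝ

inductive ArcColor
  | red
  | blue
  deriving DecidableEq

/-- A red-blue coloured directed path with `len` arcs: its vertices are
`vert 0, …, vert len`, and its `i`-th arc, from `vert i` to `vert (i + 1)` with `i < len`, has the
colour `color i`. Values of `vert` and `color` at larger indices carry no meaning. -/
structure ColoredPath (E : Type*) where
  len : ℕ
  vert : ℕ → E
  color : ℕ → ArcColor

namespace BasisPairInstance

variable {E : Type*} [Fintype E] [DecidableEq E]

/-- The objective `c₁(X) + c₂(Y)`. -/
def cost (I : BasisPairInstance E) (X Y : Finset E) : ℝ :=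
  ∑ e ∈ X, I.c₁ e + ∑ e ∈ Y, I.c₂ e

/-- `(X, Y)` is a feasible solution of the problem with constraint `|X ∩ Y| = k`. -/
def IsFeasible (I : BasisPairInstance E) (k : ℕ) (X Y : Finset E) : Prop :=
  I.M₁.IsBase (X : Set E) ∧ I.M₂.IsBase (Y : Set E) ∧ (X ∩ Y).card = k

/-- `(X, Y)` is an optimal solution of the problem with constraint `|X ∩ Y| = k`. -/
def IsOptimal (I : BasisPairInstance E) (k : ℕ) (X Y : Finset E) : Prop :=
  I.IsFeasible k X Y ∧ ∀ X' Y' : Finset E, I.IsFeasible k X' Y' → I.cost X Y ≤ I.cost X' Y'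

/-- `(X, Y)` is an optimal solution of the problem without constraint on `|X ∩ Y|`. -/
def IsUnconstrainedOptimal (I : BasisPairInstance E) (X Y : Finset E) : Prop :=
  I.M₁.IsBase (X : Set E) ∧ I.M₂.IsBase (Y : Set E) ∧
    ∀ X' Y' : Finset E, I.M₁.IsBase (X' : Set E) → I.M₂.IsBase (Y' : Set E) →
      I.cost X Y ≤ I.cost X' Y'

/-- The instance with the second matroid replaced by its dual and `c₂` by `-c₂`. -/
def dualize (I : BasisPairInstance E) : BasisPairInstance E where
  M₁ := I.M₁
  M₂ := I.M₂.dual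
  ground₁ := I.ground₁
  ground₂ := I.ground₂
  c₁ := I.c₁
  c₂ := fun e => -I.c₂ e

/-- The coloured arcs of the auxiliary digraph `D(X, Y, α, β)`. A red arc `(e, f)` is a move from
`X` to `X - f + e`, a blue arc `(e, f)` is a move from `Y` to `Y - e + f`. -/
def Arc (I : BasisPairInstance E) (s : PDState E) : ArcColor → E → E → Prop
  | .red, e, f => e ∉ s.X ∧ f ∈ s.X ∧ I.M₁.IsBase (insert e (s.X.erase f) : Set E) ∧
      I.c₁ e - s.α e = I.c₁ f - s.α f
  | .blue, e, f => f ∉ s.Y ∧ e ∈ s.Y ∧ I.M₂.IsBase (insert f (s.Y.erase e) : Set E) ∧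
      I.c₂ f - s.β f = I.c₂ e - s.β e

/-- `P` is a red-blue alternating path in the auxiliary digraph that starts in `Y \ X`. -/
def IsAlternatingPath (I : BasisPairInstance E) (s : PDState E) (P : ColoredPath E) : Prop :=
  P.vert 0 ∈ s.Y \ s.X ∧
  (∀ i < P.len, I.Arc s (P.color i) (P.vert i) (P.vert (i + 1))) ∧
  (∀ i, i + 1 < P.len → P.color i ≠ P.color (i + 1)) ∧
  Set.InjOn P.vert (Set.Iic P.len)

/-- `P` is a red-blue alternating path from `Y \ X` to `X \ Y`. -/
def IsLinkingPath (I : BasisPairInstance E) (s : PDState E) (P : ColoredPath E) : Prop :=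
  I.IsAlternatingPath s P ∧ P.vert P.len ∈ s.X \ s.Y

/-- An augmenting path: a red-blue alternating path from `Y \ X` to `X \ Y` with the fewest
arcs. -/
def IsAugmentingPath (I : BasisPairInstance E) (s : PDState E) (P : ColoredPath E) : Prop :=
  I.IsLinkingPath s P ∧ ∀ Q : ColoredPath E, I.IsLinkingPath s Q → P.len ≤ Q.len

/-- The set `R` of elements reachable from `Y \ X` on a red-blue alternating path. -/
def reachable (I : BasisPairInstance E) (s : PDState E) : Set E :=
  {e | ∃ P : ColoredPath E, I.IsAlternatingPath s P ∧ P.vert P.len = e}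

end BasisPairInstance

namespace ColoredPath

variable {E : Type*} [DecidableEq E]

/-- The indices of the arcs of `P` that have the colour `c`. -/
def arcsOf (P : ColoredPath E) (c : ArcColor) : Finset ℕ :=
  (Finset.range P.len).filter fun i => P.color i = c

/-- `X ⊕ P`: for every red arc `(e, f)` of `P`, remove `f` from `X` and add `e`. -/
def moveRed (P : ColoredPath E) (X : Finset E) : Finset E :=
  (X \ (P.arcsOf .red).image fun i => P.vert (i + 1)) ∪ (P.arcsOf .red).image P.vert

/-- `Y ⊕ P`: for every blue arc `(e, f)` of `P`, remove `e` from `Y` and add `f`. -/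
def moveBlue (P : ColoredPath E) (Y : Finset E) : Finset E :=
  (Y \ (P.arcsOf .blue).image P.vert) ∪ (P.arcsOf .blue).image fun i => P.vert (i + 1)

end ColoredPath

namespace BasisPairInstance

variable {E : Type*} [Fintype E] [DecidableEq E]

/-- The step length `δ₁`; the infimum of the empty set is `∞`. -/
noncomputable def stepLength₁ (I : BasisPairInstance E) (s : PDState E) : EReal :=
  sInf {x | ∃ e f : E, e ∈ I.reachable s ∧ e ∉ s.X ∧ f ∈ s.X ∧ f ∉ I.reachable s ∧
    I.M₁.IsBase (insert e (s.X.erase f) : Set E) ∧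
    x = (((I.c₁ e - s.α e) - (I.c₁ f - s.α f) : ℝ) : EReal)}

/-- The step length `δ₂`; the infimum of the empty set is `∞`. -/
noncomputable def stepLength₂ (I : BasisPairInstance E) (s : PDState E) : EReal :=
  sInf {x | ∃ g f : E, g ∉ s.Y ∧ g ∉ I.reachable s ∧ f ∈ s.Y ∧ f ∈ I.reachable s ∧
    I.M₂.IsBase (insert g (s.Y.erase f) : Set E) ∧
    x = (((I.c₂ g - s.β g) - (I.c₂ f - s.β f) : ℝ) : EReal)}

/-- The step length `δ = min {δ₁, δ₂}`. -/
noncomputable def stepLength (I : BasisPairInstance E) (s : PDState E) : EReal :=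
  min (I.stepLength₁ s) (I.stepLength₂ s)

/-- The state after a primal augmentation along `P`. -/
def primalUpdate (s : PDState E) (P : ColoredPath E) : PDState E where
  X := P.moveRed s.X
  Y := P.moveBlue s.Y
  lam := s.lam
  α := s.α
  β := s.β

open Classical in
/-- The state after a dual augmentation with step length `δ`. -/
noncomputable def dualUpdate (I : BasisPairInstance E) (s : PDState E) (δ : ℝ) : PDState E where
  X := s.X
  Y := s.Y
  lam := s.lam + δ
  α := fun e => if e ∈ I.reachable s then s.α e + δ else s.α e
  β := fun e => if e ∈ I.reachable s then s.β e else s.β e + δ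

/-- One pass through the body of the main loop that leads from state `s` to state `s'`, that is,
one primal or dual augmentation. Any augmenting path may be chosen. -/
inductive Augments (I : BasisPairInstance E) (s : PDState E) : PDState E → Prop
  | primal (P : ColoredPath E) (hP : I.IsAugmentingPath s P) : Augments I s (primalUpdate s P)
  | dual (hno : ∀ P : ColoredPath E, ¬ I.IsAugmentingPath s P) (δ : ℝ)
      (hδ : I.stepLength s = (δ : EReal)) : Augments I s (I.dualUpdate s δ)

/-! The whole algorithm, on input `I` and `k`, after it has computed an unconstrained optimal pair
`(X₀, Y₀)`. If `|X₀ ∩ Y₀| ≤ k`, the main loop works on `I` with target `k` and starts from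
`(X₀, Y₀)`. Otherwise it works on the dualized instance with target `k* = rk(M₁) - k` and starts
from `(X₀, E \ Y₀)`; a pair `(X, Y)` of the loop then stands for the pair `(X, E \ Y)`. -/

/-- The instance on which the main loop works. -/
def loopInstance (I : BasisPairInstance E) (k : ℕ) (X₀ Y₀ : Finset E) : BasisPairInstance E :=
  if (X₀ ∩ Y₀).card ≤ k then I else I.dualize

/-- The size of the intersection at which the main loop ends. -/
noncomputable def loopTarget (I : BasisPairInstance E) (k : ℕ) (X₀ Y₀ : Finset E) : ℕ :=
  if (X₀ ∩ Y₀).card ≤ k then k else matroidRank I.M₁ - k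

/-- The state in which the main loop starts. -/
def loopStart (k : ℕ) (X₀ Y₀ : Finset E) : PDState E where
  X := X₀
  Y := if (X₀ ∩ Y₀).card ≤ k then Y₀ else Y₀ᶜ
  lam := 0
  α := fun _ => 0
  β := fun _ => 0

/-- The second set of the base pair of the original instance for which a state of the main loop
stands (the first set is `s.X`). -/
def currentY (k : ℕ) (X₀ Y₀ : Finset E) (s : PDState E) : Finset E :=
  if (X₀ ∩ Y₀).card ≤ k then s.Y else s.Yᶜ

/-- The states `σ 0, …, σ n` are an initial part of a run of the algorithm with parameter `k` and
initial pair `(X₀, Y₀)`, and it consists of `n` primal or dual augmentations. -/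
def IsRun (I : BasisPairInstance E) (k : ℕ) (X₀ Y₀ : Finset E) (n : ℕ) (σ : ℕ → PDState E) :
    Prop :=
  σ 0 = loopStart k X₀ Y₀ ∧
  ∀ i < n, ((σ i).X ∩ (σ i).Y).card < I.loopTarget k X₀ Y₀ ∧
    (I.loopInstance k X₀ Y₀).Augments (σ i) (σ (i + 1))

/-- In state `s` the main loop is left and the algorithm returns `(s.X, currentY k X₀ Y₀ s)`. -/
def Returns (I : BasisPairInstance E) (k : ℕ) (X₀ Y₀ : Finset E) (s : PDState E) : Prop :=
  ¬ (s.X ∩ s.Y).card < I.loopTarget k X₀ Y₀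

/-- In state `s` the algorithm stops with the message "infeasible instance". -/
def ReportsInfeasible (I : BasisPairInstance E) (k : ℕ) (X₀ Y₀ : Finset E) (s : PDState E) :
    Prop :=
  (s.X ∩ s.Y).card < I.loopTarget k X₀ Y₀ ∧
  (∀ P : ColoredPath E, ¬ (I.loopInstance k X₀ Y₀).IsAugmentingPath s P) ∧
  (I.loopInstance k X₀ Y₀).stepLength s = ⊤

/-- The base pairs of the original instance that occur in the run `σ 0, …, σ n`. -/
def runPairs (k : ℕ) (X₀ Y₀ : Finset E) (n : ℕ) (σ : ℕ → PDState E) :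
    Set (Finset E × Finset E) :=
  {p | ∃ i ≤ n, p = ((σ i).X, currentY k X₀ Y₀ (σ i))}

/-- In state `s` the algorithm stops. -/
def Stops (I : BasisPairInstance E) (k : ℕ) (X₀ Y₀ : Finset E) (s : PDState E) : Prop :=
  I.Returns k X₀ Y₀ s ∨ I.ReportsInfeasible k X₀ Y₀ s

end BasisPairInstance

/-!
The algorithm is the successive shortest path method for weighted matroid intersection, with the
multiplier `lam` of the constraint `|X ∩ Y| = k` split as `lam = α + β` over each element. It keeps
`X` and `Y` optimal for the reduced costs `c₁ - α` and `c₂ - β`, with `α, β ≥ 0`, `α = 0` on `X \ Y`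
and `β = 0` on `Y \ X` (`IsCertified`). Since `α(X') + β(Y') ≥ lam * |X' ∩ Y'|` for all bases, with
equality for the current pair, a certified pair is optimal among all pairs with the same size of the
intersection.

The minimum weight bases of a matroid are again the bases of a matroid (`Matroid.minWeight`), and the
arcs of the auxiliary digraph are the exchanges in the two matroids of this kind. A shortest path has
no shortcuts, so all its moves can be made together (`Matroid.IsBase.exchange_of_no_shortcut`); this
gives a certified pair whose intersection has one more element. In a dual augmentation all
reachable elements stay reachable and a new one is added, so that fewer than `|E|` dual augmentations
occur in a row; counting with the potential `|X ∩ Y| * |E| + |R|` bounds the length of a run. If the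
step length is infinite, then the reachable set `R` shows, by the rank argument of matroid
intersection, that no pair of bases has a larger intersection (`IsCertified.card_inter_le`).

The case `|X₀ ∩ Y₀| > k` reduces to this one, because complementing the second base turns
intersections of size `k` into intersections of size `rk(M₁) - k` and changes the cost by a
constant. In both cases `|X ∩ Y|` changes in steps of one, so a run visits all sizes between the first
and the last.
-/

/-! ### Base exchange -/

namespace Matroid

variable {E : Type*} {M : Matroid E} {B B' : Set E} {e f : E}

/-- In terms of fundamental circuits: `B - f + e` is a base exactly when `f` lies on the
fundamental circuit of `e`. -/
lemma IsBase.exchange_iff_mem_fundCircuit (hB : M.IsBase B) (heE : e ∈ M.E) (he : e ∉ B)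
    (hf : f ∈ B) : M.IsBase (insert e (B \ {f})) ↔ f ∈ M.fundCircuit e B := by
  have hne : e ≠ f := fun h => he (h ▸ hf)
  rw [hB.indep.mem_fundCircuit_iff (by rwa [hB.closure_eq]) he,
    ← Set.insert_sdiff_singleton_comm hne]
  exact ⟨fun h => h.indep, fun h => hB.exchange_isBase_of_indep he h⟩

/-- The symmetric exchange property. -/
lemma IsBase.symm_exchange (hB : M.IsBase B) (hB' : M.IsBase B') (he : e ∈ B \ B') :
    ∃ f ∈ B' \ B, M.IsBase (insert f (B \ {e})) ∧ M.IsBase (insert e (B' \ {f})) := by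
  have heE : e ∈ M.E := hB.subset_ground he.1
  have hC := hB'.fundCircuit_isCircuit heE he.2
  have hecl : e ∈ M.closure (M.fundCircuit e B' \ {e}) :=
    hC.mem_closure_sdiff_singleton_of_mem (M.mem_fundCircuit e B')
  -- the rest of the circuit cannot lie in the closure of `B - e`, since `B` is independent
  have hnot : ¬ M.fundCircuit e B' \ {e} ⊆ M.closure (B \ {e}) := fun hss =>
    hB.indep.notMem_closure_sdiff_of_mem he.1
      (M.closure_subset_closure_of_subset_closure hss hecl)
  obtain ⟨f, ⟨hfC, hfe⟩, hfcl⟩ := Set.not_subset.1 hnot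
  have hfE : f ∈ M.E := hC.subset_ground hfC
  have hfB' : f ∈ B' := ((M.fundCircuit_subset_insert e B') hfC).resolve_left hfe
  have hfB : f ∉ B := fun h => hfcl (M.mem_closure_of_mem' ⟨h, hfe⟩ hfE)
  refine ⟨f, ⟨hfB', hfB⟩, hB.exchange_base_of_notMem_closure he.1 hfcl,
    (hB'.exchange_iff_mem_fundCircuit heE he.2 hfB').2 hfC⟩

/-- If `f` is not on the fundamental circuit of `e`, then exchanging `f` for `a` does not change
this circuit. -/
lemma IsBase.fundCircuit_exchange {a : E} (hB : M.IsBase B) (hB' : M.IsBase (insert a (B \ {f})))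
    (heE : e ∈ M.E) (he : e ∉ B) (hef : f ∉ M.fundCircuit e B) :
    M.fundCircuit e (insert a (B \ {f})) = M.fundCircuit e B := by
  refine ((hB.fundCircuit_isCircuit heE he).eq_fundCircuit_of_subset hB'.indep ?_).symm
  intro x hx
  rcases M.fundCircuit_subset_insert e B hx with rfl | hxB
  · exact Set.mem_insert _ _
  · refine Set.mem_insert_of_mem _ (Set.mem_insert_of_mem _ ⟨hxB, ?_⟩)
    rintro rfl
    exact hef hx

/-- Simultaneous exchange without shortcuts: if each `B - f i + e i` is a base, but no
`B - f j + e i` with `i < j` is, then all the exchanges can be made together. -/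
lemma IsBase.exchange_of_no_shortcut {ι : Type*} [LinearOrder ι] (e f : ι → E) (S : Finset ι)
    (hE : ∀ i ∈ S, e i ∈ M.E) (hB : M.IsBase B) (he : ∀ i ∈ S, e i ∉ B) (hf : ∀ i ∈ S, f i ∈ B)
    (hex : ∀ i ∈ S, M.IsBase (insert (e i) (B \ {f i})))
    (hno : ∀ i ∈ S, ∀ j ∈ S, i < j → ¬ M.IsBase (insert (e i) (B \ {f j}))) :
    M.IsBase ((B \ f '' S) ∪ e '' S) := by
  induction S using Finset.induction_on_max generalizing B with
  | empty => simpa using hB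
  | insert m S hmax ih =>
    have hm : m ∈ insert m S := Finset.mem_insert_self _ _
    have hS : ∀ {i}, i ∈ S → i ∈ insert m S := fun h => Finset.mem_insert_of_mem h
    have hB₁ := hex m hm
    have hnm : ∀ i ∈ S, ¬ M.IsBase (insert (e i) (B \ {f m})) :=
      fun i hi => hno i (hS hi) m hm (hmax i hi)
    have hne : ∀ i ∈ S, e i ≠ e m := fun i hi h => hnm i hi (h ▸ hB₁)
    have hnf : ∀ i ∈ S, f i ≠ f m := fun i hi h => hnm i hi (h ▸ hex i (hS hi))
    have he₁ : ∀ i ∈ S, e i ∉ insert (e m) (B \ {f m}) := by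
      rintro i hi (h | h)
      · exact hne i hi h
      · exact he i (hS hi) h.1
    have hf₁ : ∀ i ∈ S, f i ∈ insert (e m) (B \ {f m}) :=
      fun i hi => Or.inr ⟨hf i (hS hi), hnf i hi⟩
    -- the exchange at the largest index alters none of the other exchanges
    have key : ∀ i ∈ S, ∀ j ∈ S, (M.IsBase (insert (e i) (insert (e m) (B \ {f m}) \ {f j})) ↔
        M.IsBase (insert (e i) (B \ {f j}))) := by
      intro i hi j hj
      have hiE := hE i (hS hi)
      rw [hB₁.exchange_iff_mem_fundCircuit hiE (he₁ i hi) (hf₁ j hj),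
        hB.exchange_iff_mem_fundCircuit hiE (he i (hS hi)) (hf j (hS hj)),
        hB.fundCircuit_exchange hB₁ hiE (he i (hS hi)) (fun h => hnm i hi
          ((hB.exchange_iff_mem_fundCircuit hiE (he i (hS hi)) (hf m hm)).2 h))]
    have := ih (fun i hi => hE i (hS hi)) hB₁ he₁ hf₁ (fun i hi => (key i hi i hi).2 (hex i (hS hi)))
      (fun i hi j hj hij h => hno i (hS hi) j (hS hj) hij ((key i hi j hj).1 h))
    convert this using 1
    have hemf : e m ∉ f '' S := by
      rintro ⟨i, hi, h⟩
      exact he m hm (h ▸ hf i (hS hi))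
    ext x
    simp only [Finset.coe_insert, Set.image_insert_eq, Set.mem_union, Set.mem_sdiff,
      Set.mem_insert_iff, Set.mem_singleton_iff]
    by_cases hx : x = e m
    · subst hx; tauto
    · tauto

/-- If no element of `R` can be exchanged for an element of the base `B` outside `R`, then
`B ∩ R` spans `R`, and hence no base meets `R` in more elements than `B`. -/
lemma IsBase.encard_inter_le_of_no_exchange {R : Set E} (hE : R ⊆ M.E) (hB : M.IsBase B)
    (hB' : M.IsBase B')
    (hno : ∀ e ∈ R, e ∉ B → ∀ f ∈ B, f ∉ R → ¬ M.IsBase (insert e (B \ {f}))) :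
    (B' ∩ R).encard ≤ (B ∩ R).encard := by
  have hspan : R ⊆ M.closure (B ∩ R) := by
    intro e he
    by_cases heB : e ∈ B
    · exact M.mem_closure_of_mem' ⟨heB, he⟩ (hE he)
    · have hC := hB.fundCircuit_isCircuit (hE he) heB
      refine M.closure_subset_closure ?_
        (hC.mem_closure_sdiff_singleton_of_mem (M.mem_fundCircuit e B))
      rintro f ⟨hfC, hfe⟩
      have hfB := (M.fundCircuit_subset_insert e B hfC).resolve_left hfe
      refine ⟨hfB, by_contra fun hfR => hno e he heB f hfB hfR ?_⟩
      exact (hB.exchange_iff_mem_fundCircuit (hE he) heB hfB).2 hfC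
  calc (B' ∩ R).encard ≤ M.eRk (M.closure (B ∩ R)) :=
        (hB'.indep.inter_right R).encard_le_eRk_of_subset (Set.inter_subset_right.trans hspan)
    _ = M.eRk (B ∩ R) := M.eRk_closure_eq _
    _ ≤ (B ∩ R).encard := M.eRk_le_encard _

/-! ### Bases of minimum weight -/

variable [Finite E]

lemma exists_minWeight_isBase (M : Matroid E) (w : E → ℝ) :
    ∃ B, M.IsBase B ∧ ∀ B', M.IsBase B' → ∑ᶠ e ∈ B, w e ≤ ∑ᶠ e ∈ B', w e := by
  obtain ⟨B, hB, hmin⟩ := Set.exists_min_image {B | M.IsBase B} (fun B => ∑ᶠ e ∈ B, w e)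
    (Set.toFinite _) M.exists_isBase
  exact ⟨B, hB, hmin⟩

lemma finsum_mem_exchange (w : E → ℝ) (he : e ∉ B) (hf : f ∈ B) :
    ∑ᶠ x ∈ insert e (B \ {f}), w x = ∑ᶠ x ∈ B, w x + w e - w f := by
  have h1 : ∑ᶠ x ∈ insert e (B \ {f}), w x = w e + ∑ᶠ x ∈ B \ {f}, w x :=
    finsum_mem_insert w (fun h => he h.1) (Set.toFinite _)
  have h2 : ∑ᶠ x ∈ insert f (B \ {f}), w x = w f + ∑ᶠ x ∈ B \ {f}, w x :=
    finsum_mem_insert w (fun h => h.2 rfl) (Set.toFinite _)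
  rw [Set.insert_sdiff_singleton, Set.insert_eq_of_mem hf] at h2
  linarith

/-- The matroid whose bases are the bases of `M` of minimum weight with respect to `w`. The exchange
axiom holds because the two exchanges of a symmetric exchange between minimum weight bases change
the weight by opposite amounts, neither of them negative. -/
noncomputable def minWeight (M : Matroid E) (w : E → ℝ) : Matroid E :=
  Matroid.ofIsBaseOfFinite (Set.toFinite M.E)
    (fun B => M.IsBase B ∧ ∀ B', M.IsBase B' → ∑ᶠ e ∈ B, w e ≤ ∑ᶠ e ∈ B', w e)
    (M.exists_minWeight_isBase w)
    (by
      rintro B B' ⟨hB, hmin⟩ ⟨hB', hmin'⟩ e he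
      obtain ⟨f, hf, h1, h2⟩ := hB.symm_exchange hB' he
      have w1 := hmin _ h1
      have w2 := hmin' _ h2
      rw [finsum_mem_exchange w hf.2 he.1] at w1
      rw [finsum_mem_exchange w he.2 hf.1] at w2
      refine ⟨f, hf, h1, fun B'' hB'' => ?_⟩
      rw [finsum_mem_exchange w hf.2 he.1]
      linarith [hmin _ hB''])
    (fun B hB => hB.1.subset_ground)

@[simp] lemma minWeight_ground (M : Matroid E) (w : E → ℝ) : (M.minWeight w).E = M.E := rfl

lemma minWeight_isBase_iff {w : E → ℝ} : (M.minWeight w).IsBase B ↔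
    M.IsBase B ∧ ∀ B', M.IsBase B' → ∑ᶠ e ∈ B, w e ≤ ∑ᶠ e ∈ B', w e := Iff.rfl

lemma IsBase.isBase_of_minWeight {w : E → ℝ} (hB : (M.minWeight w).IsBase B) : M.IsBase B :=
  (minWeight_isBase_iff.1 hB).1

/-- The exchanges in the matroid of minimum weight bases are the tight exchanges of `M`. -/
lemma IsBase.minWeight_exchange_iff {w : E → ℝ} (hB : (M.minWeight w).IsBase B) (he : e ∉ B)
    (hf : f ∈ B) : (M.minWeight w).IsBase (insert e (B \ {f})) ↔
      M.IsBase (insert e (B \ {f})) ∧ w e = w f := by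
  rw [minWeight_isBase_iff] at hB ⊢
  refine and_congr_right fun h => ⟨fun hmin => ?_, fun hw B' hB' => ?_⟩
  · have h1 := hB.2 _ h
    have h2 := hmin _ hB.1
    rw [finsum_mem_exchange w he hf] at h1 h2
    linarith
  · rw [finsum_mem_exchange w he hf]
    linarith [hB.2 _ hB']

lemma IsBase.le_of_minWeight_exchange {w : E → ℝ} (hB : (M.minWeight w).IsBase B) (he : e ∉ B)
    (hf : f ∈ B) (h : M.IsBase (insert e (B \ {f}))) : w f ≤ w e := by
  have h1 := (minWeight_isBase_iff.1 hB).2 _ h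
  rw [finsum_mem_exchange w he hf] at h1
  linarith

/-- A base that no single exchange improves has minimum weight. -/
lemma IsBase.minWeight_of_local {w : E → ℝ} (hB : M.IsBase B)
    (hloc : ∀ e f, e ∉ B → f ∈ B → M.IsBase (insert e (B \ {f})) → w f ≤ w e) :
    (M.minWeight w).IsBase B := by
  -- take a minimum weight base `A` as close as possible to `B`
  obtain ⟨A, hA, hclose⟩ := Set.exists_min_image {A | (M.minWeight w).IsBase A}
    (fun A => (B \ A).ncard) (Set.toFinite _) (M.minWeight w).exists_isBase
  by_cases hsub : B ⊆ A
  · rw [hB.eq_of_subset_isBase (IsBase.isBase_of_minWeight hA) hsub]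
    exact hA
  exfalso
  obtain ⟨e, heB, heA⟩ := Set.not_subset.1 hsub
  obtain ⟨f, hf, h1, h2⟩ := hB.symm_exchange (IsBase.isBase_of_minWeight hA) ⟨heB, heA⟩
  have hA' : (M.minWeight w).IsBase (insert e (A \ {f})) :=
    (IsBase.minWeight_exchange_iff hA heA hf.1).2 ⟨h2,
      le_antisymm (hloc f e hf.2 heB h1) (IsBase.le_of_minWeight_exchange hA heA hf.1 h2)⟩
  have := hclose _ hA'
  refine absurd this (not_le.2 (Set.ncard_lt_ncard ⟨?_, fun hss => ?_⟩ (Set.toFinite _)))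
  · rintro x ⟨hxB, hx⟩
    refine ⟨hxB, fun hxA => hx (Or.inr ⟨hxA, ?_⟩)⟩
    rintro rfl
    exact hf.2 hxB
  · exact (hss ⟨heB, heA⟩).2 (Or.inl rfl)

end Matroid

/-! ### The auxiliary digraph -/

namespace BasisPairInstance

variable {E : Type*} {I : BasisPairInstance E} {s : PDState E}

section

variable [DecidableEq E]

/-- A red arc ends in `X`, where no red arc starts, and a blue arc ends outside `Y`, where no blue
arc starts. Hence every directed path of `D` alternates. -/
lemma Arc.color_ne {c c' : ArcColor} {e f g : E} (h : I.Arc s c e f) (h' : I.Arc s c' f g) :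
    c ≠ c' := by
  rintro rfl
  cases c
  · exact h'.1 h.2.1
  · exact h.1 h'.2.1

lemma isAlternatingPath_of_arcs {P : ColoredPath E} (h0 : P.vert 0 ∈ s.Y \ s.X)
    (harc : ∀ i < P.len, I.Arc s (P.color i) (P.vert i) (P.vert (i + 1)))
    (hinj : Set.InjOn P.vert (Set.Iic P.len)) : I.IsAlternatingPath s P :=
  ⟨h0, harc, fun i hi => (harc i (by omega)).color_ne (harc (i + 1) hi), hinj⟩

lemma IsAlternatingPath.vert_mem_reachable {P : ColoredPath E} (hP : I.IsAlternatingPath s P)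
    {i : ℕ} (hi : i ≤ P.len) : P.vert i ∈ I.reachable s := by
  obtain ⟨h0, harc, -, hinj⟩ := hP
  refine ⟨{ P with len := i }, isAlternatingPath_of_arcs h0
    (fun j (hj : j < i) => harc j (by omega)) (hinj.mono ?_), rfl⟩
  exact Set.Iic_subset_Iic.2 hi

lemma mem_reachable_of_mem_sdiff {e : E} (hY : e ∈ s.Y) (hX : e ∉ s.X) : e ∈ I.reachable s :=
  ⟨⟨0, fun _ => e, fun _ => .red⟩, isAlternatingPath_of_arcs (Finset.mem_sdiff.2 ⟨hY, hX⟩)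
    (fun _ hi => absurd hi (Nat.not_lt_zero _))
    (fun i hi j hj _ => by simp only [Set.mem_Iic] at hi hj; omega), rfl⟩

/-- The reachable set is closed under all arcs: alternation is automatic, and if the end of the arc
already lies on the path, then an initial part of the path reaches it. -/
lemma Arc.mem_reachable {c : ArcColor} {e f : E} (h : I.Arc s c e f) (he : e ∈ I.reachable s) :
    f ∈ I.reachable s := by
  obtain ⟨P, hP, rfl⟩ := he
  by_cases hf : ∃ i ≤ P.len, P.vert i = f
  · obtain ⟨i, hi, rfl⟩ := hf
    exact hP.vert_mem_reachable hi
  push Not at hf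
  obtain ⟨h0, harc, -, hinj⟩ := hP
  refine ⟨⟨P.len + 1, fun i => if i ≤ P.len then P.vert i else f,
    fun i => if i < P.len then P.color i else c⟩, isAlternatingPath_of_arcs (by simpa using h0)
    (fun i (hi : i < P.len + 1) => ?_) (fun i hi j hj hij => ?_), by simp⟩
  · by_cases hlt : i < P.len
    · simpa [hlt, hlt.le, Nat.succ_le_of_lt hlt] using harc i hlt
    · obtain rfl : i = P.len := by omega
      simpa using h
  · simp only [Set.mem_Iic] at hi hj hij
    split_ifs at hij with h1 h2 h2
    · exact hinj h1 h2 hij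
    · exact absurd hij (hf i h1)
    · exact absurd hij.symm (hf j h2)
    · omega

lemma reachable_induction {p : E → Prop} (h0 : ∀ e ∈ s.Y, e ∉ s.X → p e)
    (hstep : ∀ c e f, e ∈ I.reachable s → f ∈ I.reachable s → I.Arc s c e f → p e → p f) :
    ∀ e ∈ I.reachable s, p e := by
  rintro e ⟨P, hP, rfl⟩
  have : ∀ i ≤ P.len, p (P.vert i) := by
    intro i
    induction i with
    | zero => exact fun _ => h0 _ (Finset.mem_sdiff.1 hP.1).1 (Finset.mem_sdiff.1 hP.1).2
    | succ i ih =>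
      intro hi
      exact hstep _ _ _ (hP.vert_mem_reachable (by omega)) (hP.vert_mem_reachable hi)
        (hP.2.1 i hi) (ih (by omega))
  exact this _ le_rfl

lemma IsLinkingPath.exists_isAugmentingPath {P : ColoredPath E} (hP : I.IsLinkingPath s P) :
    ∃ Q, I.IsAugmentingPath s Q := by
  classical
  have hex : ∃ n, ∃ Q : ColoredPath E, I.IsLinkingPath s Q ∧ Q.len = n := ⟨_, P, hP, rfl⟩
  obtain ⟨Q, hQ, hlen⟩ := Nat.find_spec hex
  exact ⟨Q, hQ, fun Q' hQ' => hlen ▸ Nat.find_min' hex ⟨Q', hQ', rfl⟩⟩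

/-- Without augmenting path no element of `X \ Y` is reachable. -/
lemma mem_right_of_mem_reachable (hno : ∀ P, ¬ I.IsAugmentingPath s P) {e : E}
    (he : e ∈ I.reachable s) (hX : e ∈ s.X) : e ∈ s.Y := by
  obtain ⟨P, hP, rfl⟩ := he
  by_contra hY
  obtain ⟨Q, hQ⟩ := IsLinkingPath.exists_isAugmentingPath ⟨hP, Finset.mem_sdiff.2 ⟨hX, hY⟩⟩
  exact hno Q hQ

/-! ### The step length -/

lemma stepLength_le_red {e f : E} (heR : e ∈ I.reachable s) (he : e ∉ s.X) (hf : f ∈ s.X)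
    (hfR : f ∉ I.reachable s) (h : I.M₁.IsBase (insert e ((s.X : Set E) \ {f}))) :
    I.stepLength s ≤ (((I.c₁ e - s.α e) - (I.c₁ f - s.α f) : ℝ) : EReal) :=
  (min_le_left _ _).trans (sInf_le ⟨e, f, heR, he, hf, hfR, by rwa [Finset.coe_erase], rfl⟩)

lemma stepLength_le_blue {g f : E} (hg : g ∉ s.Y) (hgR : g ∉ I.reachable s) (hf : f ∈ s.Y)
    (hfR : f ∈ I.reachable s) (h : I.M₂.IsBase (insert g ((s.Y : Set E) \ {f}))) :
    I.stepLength s ≤ (((I.c₂ g - s.β g) - (I.c₂ f - s.β f) : ℝ) : EReal) :=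
  (min_le_right _ _).trans (sInf_le ⟨g, f, hg, hgR, hf, hfR, by rwa [Finset.coe_erase], rfl⟩)

/-- A finite step length is attained by an exchange. -/
lemma stepLength_attained [Finite E] (hs : I.stepLength s ≠ ⊤) :
    (∃ e f : E, e ∈ I.reachable s ∧ e ∉ s.X ∧ f ∈ s.X ∧ f ∉ I.reachable s ∧
      I.M₁.IsBase (insert e ((s.X : Set E) \ {f})) ∧
      I.stepLength s = (((I.c₁ e - s.α e) - (I.c₁ f - s.α f) : ℝ) : EReal)) ∨
    (∃ g f : E, g ∉ s.Y ∧ g ∉ I.reachable s ∧ f ∈ s.Y ∧ f ∈ I.reachable s ∧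
      I.M₂.IsBase (insert g ((s.Y : Set E) \ {f})) ∧
      I.stepLength s = (((I.c₂ g - s.β g) - (I.c₂ f - s.β f) : ℝ) : EReal)) := by
  have hmem : ∀ S : Set EReal, S.Finite → sInf S ≠ ⊤ → sInf S ∈ S := fun S hfin hne =>
    Set.Nonempty.csInf_mem (Set.nonempty_iff_ne_empty.2 fun h0 => hne (by rw [h0, sInf_empty])) hfin
  rcases min_choice (I.stepLength₁ s) (I.stepLength₂ s) with h | h
  · left
    have h' : I.stepLength s = I.stepLength₁ s := h
    rw [h'] at hs ⊢
    have := hmem _ ((Set.finite_range fun p : E × E =>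
      (((I.c₁ p.1 - s.α p.1) - (I.c₁ p.2 - s.α p.2) : ℝ) : EReal)).subset (by
        rintro x ⟨e, f, -, -, -, -, -, rfl⟩
        exact ⟨(e, f), rfl⟩)) hs
    obtain ⟨e, f, h1, h2, h3, h4, hb, h5⟩ := this
    exact ⟨e, f, h1, h2, h3, h4, by rwa [Finset.coe_erase] at hb, h5⟩
  · right
    have h' : I.stepLength s = I.stepLength₂ s := h
    rw [h'] at hs ⊢
    have := hmem _ ((Set.finite_range fun p : E × E =>
      (((I.c₂ p.1 - s.β p.1) - (I.c₂ p.2 - s.β p.2) : ℝ) : EReal)).subset (by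
        rintro x ⟨e, f, -, -, -, -, -, rfl⟩
        exact ⟨(e, f), rfl⟩)) hs
    obtain ⟨e, f, h1, h2, h3, h4, hb, h5⟩ := this
    exact ⟨e, f, h1, h2, h3, h4, by rwa [Finset.coe_erase] at hb, h5⟩

lemma exists_stepLength_eq_coe [Finite E] (hs : I.stepLength s ≠ ⊤) :
    ∃ δ : ℝ, I.stepLength s = (δ : EReal) := by
  rcases stepLength_attained hs with ⟨e, f, -, -, -, -, -, h⟩ | ⟨e, f, -, -, -, -, -, h⟩
  exacts [⟨_, h⟩, ⟨_, h⟩]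

lemma reachable_nonempty_of_stepLength_ne_top [Finite E] (hs : I.stepLength s ≠ ⊤) :
    (I.reachable s).Nonempty := by
  rcases stepLength_attained hs with ⟨e, f, h, -⟩ | ⟨e, f, -, -, -, h, -⟩
  exacts [⟨_, h⟩, ⟨_, h⟩]

end

/-! ### Optimality certificates -/

variable [Fintype E]

/-- The optimality certificate maintained by the algorithm: `X` and `Y` are bases of minimum weight
for the reduced costs `c₁ - α` and `c₂ - β`, where `α, β ≥ 0` split the multiplier `lam` of the
constraint `|X ∩ Y| = k`, with `α = 0` on `X \ Y` and `β = 0` on `Y \ X`. -/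
structure IsCertified (I : BasisPairInstance E) (s : PDState E) : Prop where
  isBase_X : (I.M₁.minWeight fun e => I.c₁ e - s.α e).IsBase (s.X : Set E)
  isBase_Y : (I.M₂.minWeight fun e => I.c₂ e - s.β e).IsBase (s.Y : Set E)
  α_nonneg : ∀ e, 0 ≤ s.α e
  β_nonneg : ∀ e, 0 ≤ s.β e
  add_eq : ∀ e, s.α e + s.β e = s.lam
  α_eq_zero : ∀ e ∈ s.X, e ∉ s.Y → s.α e = 0
  β_eq_zero : ∀ e ∈ s.Y, e ∉ s.X → s.β e = 0

lemma IsCertified.isBase₁ (h : I.IsCertified s) : I.M₁.IsBase (s.X : Set E) :=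
  h.isBase_X.isBase_of_minWeight

lemma IsCertified.isBase₂ (h : I.IsCertified s) : I.M₂.IsBase (s.Y : Set E) :=
  h.isBase_Y.isBase_of_minWeight

variable [DecidableEq E]

/-- For every pair of bases, `α(X') + β(Y') ≥ lam * |X' ∩ Y'|`, with equality for `(X, Y)`. So
`(X, Y)` minimizes `c₁(X') + c₂(Y') - lam * |X' ∩ Y'|`. -/
lemma IsCertified.isOptimal (h : I.IsCertified s) :
    I.IsOptimal (s.X ∩ s.Y).card s.X s.Y := by
  refine ⟨⟨h.isBase₁, h.isBase₂, rfl⟩, fun X' Y' ⟨hX', hY', hcard⟩ => ?_⟩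
  have hX := (Matroid.minWeight_isBase_iff.1 h.isBase_X).2 _ hX'
  have hY := (Matroid.minWeight_isBase_iff.1 h.isBase_Y).2 _ hY'
  simp only [finsum_mem_coe_finset, Finset.sum_sub_distrib] at hX hY
  have hsum : ∀ A : Finset E, ∑ e ∈ A, s.α e + ∑ e ∈ A, s.β e = A.card * s.lam := by
    intro A
    rw [← Finset.sum_add_distrib, Finset.sum_congr rfl fun e _ => h.add_eq e]
    simp
  have hα : ∑ e ∈ s.X ∩ s.Y, s.α e = ∑ e ∈ s.X, s.α e :=
    Finset.sum_subset Finset.inter_subset_left fun e he hn =>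
      h.α_eq_zero e he fun hY => hn (Finset.mem_inter.2 ⟨he, hY⟩)
  have hβ : ∑ e ∈ s.X ∩ s.Y, s.β e = ∑ e ∈ s.Y, s.β e :=
    Finset.sum_subset Finset.inter_subset_right fun e he hn =>
      h.β_eq_zero e he fun hX => hn (Finset.mem_inter.2 ⟨hX, he⟩)
  have hα' : ∑ e ∈ X' ∩ Y', s.α e ≤ ∑ e ∈ X', s.α e :=
    Finset.sum_le_sum_of_subset_of_nonneg Finset.inter_subset_left fun e _ _ => h.α_nonneg e
  have hβ' : ∑ e ∈ X' ∩ Y', s.β e ≤ ∑ e ∈ Y', s.β e :=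
    Finset.sum_le_sum_of_subset_of_nonneg Finset.inter_subset_right fun e _ _ => h.β_nonneg e
  have h1 := hsum (s.X ∩ s.Y)
  have h2 := hsum (X' ∩ Y')
  rw [hcard] at h2
  unfold cost
  linarith

lemma IsCertified.arc_red_iff (h : I.IsCertified s) {e f : E} :
    I.Arc s .red e f ↔ e ∉ s.X ∧ f ∈ s.X ∧
      (I.M₁.minWeight fun e => I.c₁ e - s.α e).IsBase (insert e ((s.X : Set E) \ {f})) := by
  refine and_congr_right fun he => and_congr_right fun hf => ?_
  rw [h.isBase_X.minWeight_exchange_iff (by simpa) (by simpa), Finset.coe_erase]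

lemma IsCertified.arc_blue_iff (h : I.IsCertified s) {f g : E} :
    I.Arc s .blue f g ↔ g ∉ s.Y ∧ f ∈ s.Y ∧
      (I.M₂.minWeight fun e => I.c₂ e - s.β e).IsBase (insert g ((s.Y : Set E) \ {f})) := by
  refine and_congr_right fun he => and_congr_right fun hf => ?_
  rw [h.isBase_Y.minWeight_exchange_iff (by simpa) (by simpa), Finset.coe_erase]

/-- If no augmenting path exists and the step length is infinite, then no pair of bases has a
larger intersection: with the reachable set `R`, the set `X ∩ R` spans `R` in the first matroid,
`Y \ R` spans the complement of `R` in the second, and both sets lie in `X ∩ Y`. -/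
lemma IsCertified.card_inter_le (h : I.IsCertified s) (hno : ∀ P, ¬ I.IsAugmentingPath s P)
    (htop : I.stepLength s = ⊤) {X' Y' : Finset E} (hX' : I.M₁.IsBase (X' : Set E))
    (hY' : I.M₂.IsBase (Y' : Set E)) : (X' ∩ Y').card ≤ (s.X ∩ s.Y).card := by
  classical
  set R : Finset E := (I.reachable s).toFinset with hR
  have hmem : ∀ e, e ∈ R ↔ e ∈ I.reachable s := fun e => Set.mem_toFinset
  have h1 : (X' ∩ R).card ≤ (s.X ∩ R).card := by
    have := h.isBase₁.encard_inter_le_of_no_exchange (R := (R : Set E))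
      (by rw [I.ground₁]; exact Set.subset_univ _) hX' (fun e heR he f hf hfR hb => by
        have := stepLength_le_red ((hmem e).1 heR) (by simpa using he) (by simpa using hf)
          (fun hc => hfR ((hmem f).2 hc)) hb
        rw [htop] at this
        exact absurd (top_le_iff.1 this) (EReal.coe_ne_top _))
    simpa only [← Finset.coe_inter, Set.encard_coe_eq_coe_finsetCard, Nat.cast_le] using this
  have h2 : (Y' ∩ Rᶜ).card ≤ (s.Y ∩ Rᶜ).card := by
    have := h.isBase₂.encard_inter_le_of_no_exchange (R := ((Rᶜ : Finset E) : Set E))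
      (by rw [I.ground₂]; exact Set.subset_univ _) hY' (fun g hgR hg f hf hfR hb => by
        have := stepLength_le_blue (by simpa using hg)
          (fun hc => Finset.mem_compl.1 hgR ((hmem g).2 hc)) (by simpa using hf)
          ((hmem f).1 (by simpa using hfR)) hb
        rw [htop] at this
        exact absurd (top_le_iff.1 this) (EReal.coe_ne_top _))
    simpa only [← Finset.coe_inter, Set.encard_coe_eq_coe_finsetCard, Nat.cast_le] using this
  have h3 : (X' ∩ Y').card ≤ (X' ∩ R).card + (Y' ∩ Rᶜ).card := by
    refine (Finset.card_le_card fun e he => ?_).trans (Finset.card_union_le _ _)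
    simp only [Finset.mem_union, Finset.mem_inter, Finset.mem_compl] at he ⊢
    tauto
  have h4 : (s.X ∩ R).card + (s.Y ∩ Rᶜ).card ≤ (s.X ∩ s.Y).card := by
    rw [← Finset.card_union_of_disjoint]
    · refine Finset.card_le_card fun e he => ?_
      simp only [Finset.mem_union, Finset.mem_inter, Finset.mem_compl, hmem] at he ⊢
      rcases he with ⟨hX, hr⟩ | ⟨hY, hr⟩
      · exact ⟨hX, mem_right_of_mem_reachable hno hr hX⟩
      · exact ⟨by_contra fun hX => hr (mem_reachable_of_mem_sdiff hY hX), hY⟩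
    · refine Finset.disjoint_left.2 fun e he he' => ?_
      exact Finset.mem_compl.1 (Finset.mem_inter.1 he').2 (Finset.mem_inter.1 he).2
  omega

/-! ### Dual augmentation -/

/-- An exchange of reduced cost zero would be an arc that leaves the reachable set. -/
lemma IsCertified.stepLength_pos (h : I.IsCertified s) {δ : ℝ}
    (hδ : I.stepLength s = (δ : EReal)) : 0 < δ := by
  have hs : I.stepLength s ≠ ⊤ := by rw [hδ]; exact EReal.coe_ne_top _
  rcases stepLength_attained hs with
    ⟨e, f, heR, he, hf, hfR, hb, h'⟩ | ⟨g, f, hg, hgR, hf, hfR, hb, h'⟩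
  · rw [hδ, EReal.coe_eq_coe_iff] at h'
    have hle := h.isBase_X.le_of_minWeight_exchange (by simpa) (by simpa) hb
    refine lt_of_le_of_ne (by linarith) fun h0 => hfR (Arc.mem_reachable (c := .red) ?_ heR)
    exact ⟨he, hf, by rwa [Finset.coe_erase], by linarith⟩
  · rw [hδ, EReal.coe_eq_coe_iff] at h'
    have hle := h.isBase_Y.le_of_minWeight_exchange (by simpa) (by simpa) hb
    refine lt_of_le_of_ne (by linarith) fun h0 => hgR (Arc.mem_reachable (c := .blue) ?_ hfR)
    exact ⟨hg, hf, by rwa [Finset.coe_erase], by linarith⟩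

lemma IsCertified.dualUpdate (h : I.IsCertified s) (hno : ∀ P, ¬ I.IsAugmentingPath s P) {δ : ℝ}
    (hδ : I.stepLength s = (δ : EReal)) : I.IsCertified (I.dualUpdate s δ) := by
  have hpos := h.stepLength_pos hδ
  refine ⟨?_, ?_, fun e => ?_, fun e => ?_, fun e => ?_, fun e he he' => ?_, fun e he he' => ?_⟩
  · refine h.isBase₁.minWeight_of_local fun e f he hf hb => ?_
    have hle := h.isBase_X.le_of_minWeight_exchange he hf hb
    simp only [BasisPairInstance.dualUpdate]
    split_ifs with h1 h2 h2
    · linarith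
    · linarith
    · have := stepLength_le_red h2 he hf h1 hb
      rw [hδ, EReal.coe_le_coe_iff] at this
      linarith
    · exact hle
  · refine h.isBase₂.minWeight_of_local fun e f he hf hb => ?_
    have hle := h.isBase_Y.le_of_minWeight_exchange he hf hb
    simp only [BasisPairInstance.dualUpdate]
    split_ifs with h1 h2 h2
    · exact hle
    · have := stepLength_le_blue he h2 hf h1 hb
      rw [hδ, EReal.coe_le_coe_iff] at this
      linarith
    · linarith
    · linarith
  · have := h.α_nonneg e
    simp only [BasisPairInstance.dualUpdate]
    split_ifs <;> linarith
  · have := h.β_nonneg e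
    simp only [BasisPairInstance.dualUpdate]
    split_ifs <;> linarith
  · have := h.add_eq e
    simp only [BasisPairInstance.dualUpdate]
    split_ifs <;> linarith
  · have hR : e ∉ I.reachable s := fun hR => he' (mem_right_of_mem_reachable hno hR he)
    simp only [BasisPairInstance.dualUpdate, if_neg hR]
    exact h.α_eq_zero e he he'
  · have hR : e ∈ I.reachable s := mem_reachable_of_mem_sdiff he he'
    simp only [BasisPairInstance.dualUpdate, if_pos hR]
    exact h.β_eq_zero e he he'

/-- Arcs inside the reachable set stay tight in a dual augmentation, and the exchange that attains
the step length becomes a new arc that leaves it. -/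
lemma reachable_ssubset_dualUpdate {δ : ℝ} (hδ : I.stepLength s = (δ : EReal)) :
    I.reachable s ⊂ I.reachable (I.dualUpdate s δ) := by
  have hsub : ∀ e ∈ I.reachable s, e ∈ I.reachable (I.dualUpdate s δ) := by
    refine reachable_induction (fun e hY hX => mem_reachable_of_mem_sdiff hY hX) ?_
    intro c e f heR hfR harc he
    refine Arc.mem_reachable (c := c) ?_ he
    cases c
    · refine ⟨harc.1, harc.2.1, harc.2.2.1, ?_⟩
      simp only [dualUpdate, if_pos heR, if_pos hfR]
      linarith [harc.2.2.2]
    · refine ⟨harc.1, harc.2.1, harc.2.2.1, ?_⟩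
      simp only [dualUpdate, if_pos heR, if_pos hfR]
      exact harc.2.2.2
  refine ⟨hsub, fun hsup => ?_⟩
  have hs : I.stepLength s ≠ ⊤ := by rw [hδ]; exact EReal.coe_ne_top _
  rcases stepLength_attained hs with
    ⟨e, f, heR, he, hf, hfR, hb, h'⟩ | ⟨g, f, hg, hgR, hf, hfR, hb, h'⟩
  · rw [hδ, EReal.coe_eq_coe_iff] at h'
    refine hfR (hsup (Arc.mem_reachable (c := .red) ?_ (hsub e heR)))
    refine ⟨he, hf, by simpa [dualUpdate] using hb, ?_⟩
    simp only [dualUpdate, if_pos heR, if_neg hfR]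
    linarith
  · rw [hδ, EReal.coe_eq_coe_iff] at h'
    refine hgR (hsup (Arc.mem_reachable (c := .blue) ?_ (hsub f hfR)))
    refine ⟨hg, hf, by simpa [dualUpdate] using hb, ?_⟩
    simp only [dualUpdate, if_pos hfR, if_neg hgR]
    linarith

end BasisPairInstance

/-! ### Primal augmentation -/

namespace ColoredPath

variable {E : Type*} {P : ColoredPath E}

lemma mem_arcsOf {c : ArcColor} {i : ℕ} : i ∈ P.arcsOf c ↔ i < P.len ∧ P.color i = c := by
  simp [arcsOf]

variable [DecidableEq E] {x : E} {Z : Finset E}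

lemma mem_moveRed : x ∈ P.moveRed Z ↔
    (x ∈ Z ∧ ¬ ∃ j < P.len, P.color j = .red ∧ P.vert (j + 1) = x) ∨
      ∃ j < P.len, P.color j = .red ∧ P.vert j = x := by
  simp [moveRed, arcsOf, and_assoc]

lemma mem_moveBlue : x ∈ P.moveBlue Z ↔
    (x ∈ Z ∧ ¬ ∃ j < P.len, P.color j = .blue ∧ P.vert j = x) ∨
      ∃ j < P.len, P.color j = .blue ∧ P.vert (j + 1) = x := by
  simp [moveBlue, arcsOf, and_assoc]

lemma coe_moveRed : (P.moveRed Z : Set E) =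
    ((Z : Set E) \ (fun i => P.vert (i + 1)) '' (P.arcsOf .red : Set ℕ)) ∪
      P.vert '' (P.arcsOf .red : Set ℕ) := by
  simp [moveRed]

lemma coe_moveBlue : (P.moveBlue Z : Set E) =
    ((Z : Set E) \ P.vert '' (P.arcsOf .blue : Set ℕ)) ∪
      (fun i => P.vert (i + 1)) '' (P.arcsOf .blue : Set ℕ) := by
  simp [moveBlue]

end ColoredPath

namespace BasisPairInstance

section

variable {E : Type*} [DecidableEq E] {I : BasisPairInstance E} {s : PDState E}
  {P : ColoredPath E}

/-- A shortest path has no shortcut: no arc leads from the start of one of its arcs to the end of a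
later one. -/
lemma IsAugmentingPath.not_arc (hP : I.IsAugmentingPath s P) {a b : ℕ} (hab : a < b)
    (hb : b < P.len) (c : ArcColor) : ¬ I.Arc s c (P.vert a) (P.vert (b + 1)) := by
  intro h
  obtain ⟨⟨⟨h0, harc, -, hinj⟩, hend⟩, hmin⟩ := hP
  have hlink : I.IsLinkingPath s ⟨P.len - (b - a),
      fun i => if i ≤ a then P.vert i else P.vert (i + (b - a)),
      fun i => if i < a then P.color i else if i = a then c else P.color (i + (b - a))⟩ := by
    refine ⟨isAlternatingPath_of_arcs (by simpa using h0)
      (fun i (hi : i < P.len - (b - a)) => ?_) (fun i hi j hj hij => ?_), ?_⟩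
    · rcases lt_trichotomy i a with hlt | rfl | hlt
      · simpa [hlt, hlt.le, Nat.succ_le_of_lt hlt] using harc i (by omega)
      · simpa [show i + 1 + (b - i) = b + 1 by omega] using h
      · have := harc (i + (b - a)) (by omega)
        simpa [hlt.not_ge, hlt.ne', hlt.le.not_gt, show ¬ i + 1 ≤ a by omega,
          show i + 1 + (b - a) = i + (b - a) + 1 by omega] using this
    · simp only [Set.mem_Iic] at hi hj hij
      split_ifs at hij with h1 h2 h2
      all_goals
        have := hinj (Set.mem_Iic.2 (by omega)) (Set.mem_Iic.2 (by omega)) hij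
        omega
    · simpa [show ¬ P.len - (b - a) ≤ a by omega,
        show P.len - (b - a) + (b - a) = P.len by omega] using hend
  have : P.len ≤ P.len - (b - a) := hmin _ hlink
  omega

/-- An inner vertex of the path lies in both or in neither of `X` and `Y`, and the augmentation moves
it from one case to the other, so that `X \ Y` gains no element. -/
lemma IsLinkingPath.of_mem_moveRed_of_notMem_moveBlue (hP : I.IsLinkingPath s P) {x : E}
    (hX : x ∈ P.moveRed s.X) (hY : x ∉ P.moveBlue s.Y) :
    x ∈ s.X ∧ x ∉ s.Y ∧ x ≠ P.vert P.len := by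
  obtain ⟨⟨h0, harc, -, hinj⟩, hend⟩ := hP
  rw [Finset.mem_sdiff] at h0 hend
  rw [ColoredPath.mem_moveRed] at hX
  rw [ColoredPath.mem_moveBlue] at hY
  push Not at hY
  have hlen : 0 < P.len := Nat.pos_of_ne_zero fun h => h0.2 (h ▸ hend.1)
  rcases hX with ⟨hxX, hno⟩ | ⟨j, hj, hc, rfl⟩
  · by_cases hxY : x ∈ s.Y
    · exfalso
      obtain ⟨j, hj, hc, rfl⟩ := hY.1 hxY
      rcases j with _ | j
      · exact h0.2 hxX
      · have ha := harc j (by omega)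
        cases hcj : P.color j
        · exact hno ⟨j, by omega, hcj, rfl⟩
        · rw [hcj] at ha
          exact ha.1 hxY
    · refine ⟨hxX, hxY, ?_⟩
      rintro rfl
      have heq : P.len - 1 + 1 = P.len := by omega
      cases hcj : P.color (P.len - 1)
      · exact hno ⟨_, by omega, hcj, by rw [heq]⟩
      · exact hY.2 _ (by omega) hcj (by rw [heq])
  · exfalso
    have ha := harc j hj
    rw [hc] at ha
    by_cases hxY : P.vert j ∈ s.Y
    · obtain ⟨j', hj', hc', h⟩ := hY.1 hxY
      rw [hinj (Set.mem_Iic.2 hj'.le) (Set.mem_Iic.2 hj.le) h, hc] at hc'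
      cases hc'
    · rcases j with _ | j
      · exact hxY h0.1
      · have ha' := harc j (by omega)
        cases hcj : P.color j
        · rw [hcj] at ha'
          exact ha.1 ha'.2.1
        · exact hY.2 j (by omega) hcj rfl

/-- Nor does `Y \ X` gain an element. -/
lemma IsLinkingPath.of_mem_moveBlue_of_notMem_moveRed (hP : I.IsLinkingPath s P) {x : E}
    (hY : x ∈ P.moveBlue s.Y) (hX : x ∉ P.moveRed s.X) :
    x ∈ s.Y ∧ x ∉ s.X := by
  obtain ⟨⟨h0, harc, -, hinj⟩, hend⟩ := hP
  rw [Finset.mem_sdiff] at h0 hend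
  rw [ColoredPath.mem_moveRed] at hX
  rw [ColoredPath.mem_moveBlue] at hY
  push Not at hX
  rcases hY with ⟨hxY, hno⟩ | ⟨j, hj, hc, rfl⟩
  · refine ⟨hxY, fun hxX => ?_⟩
    obtain ⟨j, hj, hc, rfl⟩ := hX.1 hxX
    have hne : j + 1 ≠ P.len := fun h => hend.2 (h ▸ hxY)
    have ha := harc (j + 1) (by omega)
    cases hcj : P.color (j + 1)
    · rw [hcj] at ha
      exact ha.1 hxX
    · exact hno ⟨j + 1, by omega, hcj, rfl⟩
  · exfalso
    have ha := harc j hj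
    rw [hc] at ha
    by_cases hxX : P.vert (j + 1) ∈ s.X
    · obtain ⟨j', hj', hc', h⟩ := hX.1 hxX
      have := hinj (Set.mem_Iic.2 hj') (Set.mem_Iic.2 hj) h
      obtain rfl : j' = j := by omega
      rw [hc] at hc'
      cases hc'
    · have hne : j + 1 ≠ P.len := fun h => hxX (h ▸ hend.1)
      have ha' := harc (j + 1) (by omega)
      cases hcj : P.color (j + 1)
      · exact hX.2 (j + 1) (by omega) hcj rfl
      · rw [hcj] at ha'
        exact ha.1 ha'.2.1

/-- The augmentation along a linking path removes exactly its last vertex from `X \ Y`. -/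
lemma IsLinkingPath.moveRed_sdiff_moveBlue (hP : I.IsLinkingPath s P) :
    P.moveRed s.X \ P.moveBlue s.Y = (s.X \ s.Y).erase (P.vert P.len) := by
  ext x
  rw [Finset.mem_erase, Finset.mem_sdiff, Finset.mem_sdiff]
  refine ⟨fun ⟨hX, hY⟩ => ?_, fun ⟨hne, hX, hY⟩ => ?_⟩
  · obtain ⟨h1, h2, h3⟩ := hP.of_mem_moveRed_of_notMem_moveBlue hX hY
    exact ⟨h3, h1, h2⟩
  · obtain ⟨⟨-, harc, -, -⟩, -⟩ := hP
    -- no arc starts at a vertex of `X \ Y`, so that `x` is not on the path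
    have hout : ∀ j < P.len, P.vert j ≠ x := by
      rintro j hj rfl
      have ha := harc j hj
      cases hc : P.color j <;> rw [hc] at ha
      · exact ha.1 hX
      · exact hY ha.2.1
    have hin : ∀ j < P.len, P.vert (j + 1) ≠ x := by
      rintro j hj rfl
      refine hout (j + 1) (lt_of_le_of_ne hj ?_) rfl
      intro h
      exact hne (by rw [h])
    rw [ColoredPath.mem_moveRed, ColoredPath.mem_moveBlue]
    refine ⟨Or.inl ⟨hX, fun ⟨j, hj, _, h⟩ => hin j hj h⟩, ?_⟩
    rintro (⟨h, -⟩ | ⟨j, hj, -, h⟩)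
    · exact hY h
    · exact hin j hj h

end

variable {E : Type*} [Fintype E] [DecidableEq E] {I : BasisPairInstance E} {s : PDState E}
  {P : ColoredPath E}

lemma IsCertified.primalUpdate (h : I.IsCertified s) (hP : I.IsAugmentingPath s P) :
    I.IsCertified (primalUpdate s P) := by
  have harc := hP.1.1.2.1
  have hred : ∀ i ∈ P.arcsOf .red, I.Arc s .red (P.vert i) (P.vert (i + 1)) := fun i hi => by
    have := harc i (ColoredPath.mem_arcsOf.1 hi).1
    rwa [(ColoredPath.mem_arcsOf.1 hi).2] at this
  have hblue : ∀ i ∈ P.arcsOf .blue, I.Arc s .blue (P.vert i) (P.vert (i + 1)) := fun i hi => by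
    have := harc i (ColoredPath.mem_arcsOf.1 hi).1
    rwa [(ColoredPath.mem_arcsOf.1 hi).2] at this
  refine ⟨?_, ?_, h.α_nonneg, h.β_nonneg, h.add_eq, fun e he he' => ?_, fun e he he' => ?_⟩
  · change Matroid.IsBase _ (P.moveRed s.X : Set E)
    rw [ColoredPath.coe_moveRed]
    refine h.isBase_X.exchange_of_no_shortcut P.vert (fun i => P.vert (i + 1)) (P.arcsOf .red)
      (fun i _ => ?_) (fun i hi => (hred i hi).1) (fun i hi => (hred i hi).2.1)
      (fun i hi => (h.arc_red_iff.1 (hred i hi)).2.2) (fun i hi j hj hij hb => ?_)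
    · rw [Matroid.minWeight_ground, I.ground₁]
      exact Set.mem_univ _
    · exact hP.not_arc hij (ColoredPath.mem_arcsOf.1 hj).1 .red
        (h.arc_red_iff.2 ⟨(hred i hi).1, (hred j hj).2.1, hb⟩)
  · change Matroid.IsBase _ (P.moveBlue s.Y : Set E)
    rw [ColoredPath.coe_moveBlue]
    -- a blue arc leads from the removed to the added element, hence the reversed order of indices
    refine h.isBase_Y.exchange_of_no_shortcut (ι := ℕᵒᵈ) (fun i : ℕ => P.vert (i + 1)) P.vert
      (P.arcsOf .blue) (fun i _ => ?_) (fun i hi => (hblue i hi).1) (fun i hi => (hblue i hi).2.1)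
      (fun i hi => (h.arc_blue_iff.1 (hblue i hi)).2.2) (fun i hi j hj hij hb => ?_)
    · rw [Matroid.minWeight_ground, I.ground₂]
      exact Set.mem_univ _
    · exact hP.not_arc (OrderDual.toDual_lt_toDual.1 hij) (ColoredPath.mem_arcsOf.1 hi).1 .blue
        (h.arc_blue_iff.2 ⟨(hblue i hi).1, (hblue j hj).2.1, hb⟩)
  · obtain ⟨h1, h2, -⟩ := hP.1.of_mem_moveRed_of_notMem_moveBlue he he'
    exact h.α_eq_zero e h1 h2
  · obtain ⟨h1, h2⟩ := hP.1.of_mem_moveBlue_of_notMem_moveRed he he'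
    exact h.β_eq_zero e h1 h2

lemma IsCertified.card_primalUpdate (h : I.IsCertified s) (hP : I.IsAugmentingPath s P) :
    (P.moveRed s.X ∩ P.moveBlue s.Y).card = (s.X ∩ s.Y).card + 1 := by
  have hcard : (P.moveRed s.X).card = s.X.card := by
    have := (h.primalUpdate hP).isBase₁.encard_eq_encard_of_isBase h.isBase₁
    simpa [BasisPairInstance.primalUpdate, Set.encard_coe_eq_coe_finsetCard] using this
  have h1 := Finset.card_inter_add_card_sdiff (P.moveRed s.X) (P.moveBlue s.Y)
  have h2 := Finset.card_inter_add_card_sdiff s.X s.Y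
  rw [hP.1.moveRed_sdiff_moveBlue, Finset.card_erase_of_mem hP.1.2] at h1
  have h3 : 0 < (s.X \ s.Y).card := Finset.card_pos.2 ⟨_, hP.1.2⟩
  omega

end BasisPairInstance

/-! ### Starting pairs -/

namespace BasisPairInstance

lemma card_eq_matroidRank {E : Type*} {M : Matroid E} {X : Finset E} (hX : M.IsBase (X : Set E)) :
    X.card = matroidRank M := by
  rw [matroidRank, ← hX.encard_eq_eRank, Set.encard_coe_eq_coe_finsetCard]
  rfl

section

variable {E : Type*} [Fintype E] {I : BasisPairInstance E}

lemma exists_isUnconstrainedOptimal (I : BasisPairInstance E) :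
    ∃ X₀ Y₀ : Finset E, I.IsUnconstrainedOptimal X₀ Y₀ := by
  classical
  obtain ⟨B₁, hB₁⟩ := I.M₁.exists_isBase
  obtain ⟨B₂, hB₂⟩ := I.M₂.exists_isBase
  obtain ⟨p, hp, hmin⟩ := Set.exists_min_image
    {p : Finset E × Finset E | I.M₁.IsBase (p.1 : Set E) ∧ I.M₂.IsBase (p.2 : Set E)}
    (fun p => I.cost p.1 p.2) (Set.toFinite _)
    ⟨(B₁.toFinset, B₂.toFinset), by simpa using hB₁, by simpa using hB₂⟩
  exact ⟨p.1, p.2, hp.1, hp.2, fun X' Y' hX' hY' => hmin (X', Y') ⟨hX', hY'⟩⟩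

lemma IsUnconstrainedOptimal.isCertified {X₀ Y₀ : Finset E} (h : I.IsUnconstrainedOptimal X₀ Y₀) :
    I.IsCertified ⟨X₀, Y₀, 0, fun _ => 0, fun _ => 0⟩ := by
  classical
  obtain ⟨hX, hY, hmin⟩ := h
  refine ⟨Matroid.minWeight_isBase_iff.2 ⟨hX, fun B hB => ?_⟩,
    Matroid.minWeight_isBase_iff.2 ⟨hY, fun B hB => ?_⟩, fun _ => le_rfl, fun _ => le_rfl,
    fun _ => add_zero _, fun _ _ _ => rfl, fun _ _ _ => rfl⟩
  · have := hmin B.toFinset Y₀ (by simpa using hB) hY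
    rw [← Set.coe_toFinset B, finsum_mem_coe_finset, finsum_mem_coe_finset]
    simp only [sub_zero]
    unfold cost at this
    linarith
  · have := hmin X₀ B.toFinset hX (by simpa using hB)
    rw [← Set.coe_toFinset B, finsum_mem_coe_finset, finsum_mem_coe_finset]
    simp only [sub_zero]
    unfold cost at this
    linarith

end

end BasisPairInstance

/-! ### Runs of the main loop -/

namespace BasisPairInstance

variable {E : Type*} [Fintype E] [DecidableEq E] {I : BasisPairInstance E}

/-- A primal augmentation enlarges `X ∩ Y` by one element, a dual one enlarges the set of reachable
elements, and neither happens when nothing is reachable. -/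
lemma IsCertified.augments {s s' : PDState E} (h : I.IsCertified s) (hstep : I.Augments s s') :
    I.IsCertified s' ∧ 0 < (I.reachable s).ncard ∧
      ((s'.X ∩ s'.Y).card = (s.X ∩ s.Y).card + 1 ∨ (s'.X ∩ s'.Y).card = (s.X ∩ s.Y).card ∧
        (I.reachable s).ncard < (I.reachable s').ncard) := by
  cases hstep with
  | primal P hP =>
    exact ⟨h.primalUpdate hP, (Set.ncard_pos (Set.toFinite _)).2
      ⟨_, hP.1.1.vert_mem_reachable (Nat.zero_le _)⟩, Or.inl (h.card_primalUpdate hP)⟩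
  | dual hno δ hδ =>
    refine ⟨h.dualUpdate hno hδ, (Set.ncard_pos (Set.toFinite _)).2
      (reachable_nonempty_of_stepLength_ne_top (by rw [hδ]; exact EReal.coe_ne_top _)),
      Or.inr ⟨rfl, Set.ncard_lt_ncard (reachable_ssubset_dualUpdate hδ) (Set.toFinite _)⟩⟩

lemma ncard_reachable_le (s : PDState E) : (I.reachable s).ncard ≤ Fintype.card E := by
  rw [← Nat.card_eq_fintype_card, ← Set.ncard_univ]
  exact Set.ncard_le_ncard (Set.subset_univ _) (Set.toFinite _)

/-- The states `σ 0, …, σ n` are consecutive states of the main loop on `I` with target `t`. The first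
one is certified and does not exceed the target; it need not be a starting state of the
algorithm. -/
structure IsLoopRun (I : BasisPairInstance E) (t n : ℕ) (σ : ℕ → PDState E) : Prop where
  start : I.IsCertified (σ 0)
  start_le : ((σ 0).X ∩ (σ 0).Y).card ≤ t
  step : ∀ i < n, ((σ i).X ∩ (σ i).Y).card < t ∧ I.Augments (σ i) (σ (i + 1))

namespace IsLoopRun

variable {t n : ℕ} {σ : ℕ → PDState E}

lemma isCertified (h : I.IsLoopRun t n σ) {i : ℕ} (hi : i ≤ n) : I.IsCertified (σ i) := by
  induction i with
  | zero => exact h.start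
  | succ i ih => exact ((ih (by omega)).augments (h.step i hi).2).1

lemma card_succ (h : I.IsLoopRun t n σ) {i : ℕ} (hi : i < n) :
    ((σ (i + 1)).X ∩ (σ (i + 1)).Y).card = ((σ i).X ∩ (σ i).Y).card ∨
      ((σ (i + 1)).X ∩ (σ (i + 1)).Y).card = ((σ i).X ∩ (σ i).Y).card + 1 := by
  rcases ((h.isCertified hi.le).augments (h.step i hi).2).2.2 with h1 | h1
  · exact Or.inr h1
  · exact Or.inl h1.1

lemma card_le (h : I.IsLoopRun t n σ) {i : ℕ} (hi : i ≤ n) :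
    ((σ i).X ∩ (σ i).Y).card ≤ t := by
  rcases i with _ | i
  · exact h.start_le
  · have := (h.step i hi).1
    rcases h.card_succ hi with h1 | h1 <;> omega

lemma exists_card_eq (h : I.IsLoopRun t n σ) {k : ℕ} (hk : ((σ 0).X ∩ (σ 0).Y).card ≤ k) {i : ℕ}
    (hi : i ≤ n) (hk' : k ≤ ((σ i).X ∩ (σ i).Y).card) :
    ∃ j ≤ n, ((σ j).X ∩ (σ j).Y).card = k := by
  induction i with
  | zero => exact ⟨0, hi, le_antisymm hk hk'⟩
  | succ i ih =>
    by_cases hlt : k ≤ ((σ i).X ∩ (σ i).Y).card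
    · exact ih (by omega) hlt
    · refine ⟨i + 1, hi, ?_⟩
      rcases h.card_succ hi with h1 | h1 <;> omega

/-- Between two primal augmentations the number of reachable elements grows strictly. The maximum with
`1` only matters for a state without reachable elements, from which no augmentation starts. -/
lemma succ_le (h : I.IsLoopRun t n σ) {i : ℕ} (hi : i ≤ n) :
    i + 1 + ((σ 0).X ∩ (σ 0).Y).card * Fintype.card E ≤
      ((σ i).X ∩ (σ i).Y).card * Fintype.card E + max (I.reachable (σ i)).ncard 1 := by
  induction i with
  | zero => have := le_max_right (I.reachable (σ 0)).ncard 1; omega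
  | succ i ih =>
    obtain ⟨-, hpos, hor⟩ := (h.isCertified (by omega)).augments (h.step i hi).2
    have ih := ih (by omega)
    rw [max_eq_left (Nat.succ_le_of_lt hpos)] at ih
    rcases hor with h1 | ⟨h1, h2⟩
    · have hN : (I.reachable (σ i)).ncard ≤ Fintype.card E :=
        ncard_reachable_le _
      rw [h1, Nat.add_mul, one_mul]
      have := le_max_right (I.reachable (σ (i + 1))).ncard 1
      omega
    · rw [h1]
      have := le_max_left (I.reachable (σ (i + 1))).ncard 1
      omega

lemma length_le (h : I.IsLoopRun t n σ) :
    n ≤ (t - ((σ 0).X ∩ (σ 0).Y).card) * Fintype.card E := by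
  rcases n with _ | n
  · exact Nat.zero_le _
  · obtain ⟨-, hpos, -⟩ := (h.isCertified (by omega)).augments (h.step n (Nat.lt_succ_self n)).2
    have h1 := h.succ_le (Nat.le_succ n)
    have hlt := (h.step n (Nat.lt_succ_self n)).1
    have hN : (I.reachable (σ n)).ncard ≤ Fintype.card E :=
        ncard_reachable_le _
    rw [max_eq_left (Nat.succ_le_of_lt hpos)] at h1
    have h2 : (((σ n).X ∩ (σ n).Y).card + 1) * Fintype.card E ≤ t * Fintype.card E :=
      Nat.mul_le_mul_right _ hlt
    rw [Nat.add_mul, one_mul] at h2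
    rw [Nat.sub_mul]
    omega

end IsLoopRun

lemma exists_augments {s : PDState E} (hs : (∃ P, I.IsAugmentingPath s P) ∨ I.stepLength s ≠ ⊤) :
    ∃ s', I.Augments s s' := by
  by_cases hP : ∃ P, I.IsAugmentingPath s P
  · exact ⟨_, .primal hP.choose hP.choose_spec⟩
  · obtain ⟨δ, hδ⟩ := exists_stepLength_eq_coe (hs.resolve_left hP)
    exact ⟨_, .dual (not_exists.1 hP) δ hδ⟩

/-! ### The dualized instance -/

lemma isBase_dualize_iff {Y : Finset E} :
    I.dualize.M₂.IsBase (Y : Set E) ↔ I.M₂.IsBase ((Yᶜ : Finset E) : Set E) := by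
  rw [show I.dualize.M₂ = I.M₂✶ from rfl,
    Matroid.dual_isBase_iff (by rw [I.ground₂]; exact Set.subset_univ _), I.ground₂,
    Finset.coe_compl, Set.compl_eq_univ_sdiff]

lemma cost_dualize (X Y : Finset E) :
    I.dualize.cost X Y = I.cost X Yᶜ - ∑ e, I.c₂ e := by
  have := Finset.sum_add_sum_compl Y I.c₂
  simp only [cost, dualize, Finset.sum_neg_distrib]
  linarith

lemma card_inter_compl_add (X Y : Finset E) : (X ∩ Yᶜ).card + (X ∩ Y).card = X.card := by
  rw [← Finset.sdiff_eq_inter_compl, Finset.card_sdiff_add_card_inter]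

lemma IsUnconstrainedOptimal.dualize {X₀ Y₀ : Finset E} (h : I.IsUnconstrainedOptimal X₀ Y₀) :
    I.dualize.IsUnconstrainedOptimal X₀ Y₀ᶜ := by
  obtain ⟨hX, hY, hmin⟩ := h
  refine ⟨hX, isBase_dualize_iff.2 (by rwa [compl_compl]), fun X' Y' hX' hY' => ?_⟩
  rw [cost_dualize, cost_dualize, compl_compl]
  linarith [hmin X' Y'ᶜ hX' (isBase_dualize_iff.1 hY')]

lemma IsFeasible.dualize {k : ℕ} {X Y : Finset E} (h : I.IsFeasible k X Y) :
    I.dualize.IsFeasible (matroidRank I.M₁ - k) X Yᶜ := by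
  obtain ⟨hX, hY, hk⟩ := h
  refine ⟨hX, isBase_dualize_iff.2 (by rwa [compl_compl]), ?_⟩
  have := card_inter_compl_add X Y
  have := card_eq_matroidRank hX
  omega

lemma IsOptimal.of_dualize {k : ℕ} {X Y : Finset E} (h : I.dualize.IsOptimal k X Y) :
    I.IsOptimal (matroidRank I.M₁ - k) X Yᶜ := by
  obtain ⟨⟨hX, hY, hk⟩, hmin⟩ := h
  have hc := card_inter_compl_add X Y
  have hr := card_eq_matroidRank (M := I.M₁) hX
  refine ⟨⟨hX, isBase_dualize_iff.1 hY, by omega⟩, fun X' Y' hf => ?_⟩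
  have := hmin X' Y'ᶜ (by
    have := hf.dualize
    rwa [show matroidRank I.M₁ - (matroidRank I.M₁ - k) = k by omega] at this)
  rw [cost_dualize, cost_dualize, compl_compl] at this
  linarith

/-! ### Runs of the algorithm -/

section

variable {k n : ℕ} {X₀ Y₀ : Finset E} {σ : ℕ → PDState E}

lemma IsUnconstrainedOptimal.isLoopRun_of_le (h : I.IsUnconstrainedOptimal X₀ Y₀)
    (hk : (X₀ ∩ Y₀).card ≤ k) (hr : I.IsRun k X₀ Y₀ n σ) : I.IsLoopRun k n σ := by
  obtain ⟨h0, hstep⟩ := hr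
  simp only [loopTarget, loopInstance, if_pos hk] at hstep
  simp only [loopStart, if_pos hk] at h0
  exact ⟨h0 ▸ h.isCertified, by rw [h0]; exact hk, hstep⟩

lemma IsUnconstrainedOptimal.card_inter_compl (h : I.IsUnconstrainedOptimal X₀ Y₀) :
    (X₀ ∩ Y₀ᶜ).card = matroidRank I.M₁ - (X₀ ∩ Y₀).card := by
  have := card_inter_compl_add X₀ Y₀
  have := card_eq_matroidRank h.1
  omega

lemma IsUnconstrainedOptimal.isLoopRun_of_lt (h : I.IsUnconstrainedOptimal X₀ Y₀)
    (hk : k < (X₀ ∩ Y₀).card) (hr : I.IsRun k X₀ Y₀ n σ) :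
    I.dualize.IsLoopRun (matroidRank I.M₁ - k) n σ := by
  obtain ⟨h0, hstep⟩ := hr
  simp only [loopTarget, loopInstance, if_neg hk.not_ge] at hstep
  simp only [loopStart, if_neg hk.not_ge] at h0
  refine ⟨h0 ▸ h.dualize.isCertified, ?_, hstep⟩
  rw [h0]
  change (X₀ ∩ Y₀ᶜ).card ≤ _
  rw [h.card_inter_compl]
  omega

lemma IsUnconstrainedOptimal.length_le_of_le (h : I.IsUnconstrainedOptimal X₀ Y₀)
    (hk : (X₀ ∩ Y₀).card ≤ k) (hr : I.IsRun k X₀ Y₀ n σ) :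
    n ≤ (k - (X₀ ∩ Y₀).card) * Fintype.card E := by
  have := (h.isLoopRun_of_le hk hr).length_le
  rw [hr.1] at this
  simpa [loopStart, if_pos hk] using this

/-- In the dualized loop the intersection grows from `rk(M₁) - |X₀ ∩ Y₀|` to at most
`rk(M₁) - k`. -/
lemma IsUnconstrainedOptimal.length_le_of_lt (h : I.IsUnconstrainedOptimal X₀ Y₀)
    (hk : k < (X₀ ∩ Y₀).card) (hr : I.IsRun k X₀ Y₀ n σ) :
    n ≤ ((X₀ ∩ Y₀).card - k) * Fintype.card E := by
  have := (h.isLoopRun_of_lt hk hr).length_le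
  rw [hr.1] at this
  simp only [loopStart, if_neg hk.not_ge, h.card_inter_compl] at this
  refine this.trans (Nat.mul_le_mul_right _ ?_)
  have := card_inter_compl_add X₀ Y₀
  have := card_eq_matroidRank h.1
  omega

lemma not_isFeasible_of_reportsInfeasible (h : I.IsUnconstrainedOptimal X₀ Y₀)
    (hr : I.IsRun k X₀ Y₀ n σ) (hinf : I.ReportsInfeasible k X₀ Y₀ (σ n)) {X Y : Finset E} :
    ¬ I.IsFeasible k X Y := by
  intro hf
  obtain ⟨hlt, hno, htop⟩ := hinf
  by_cases hk : (X₀ ∩ Y₀).card ≤ k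
  · have hl := h.isLoopRun_of_le hk hr
    simp only [loopTarget, loopInstance, if_pos hk] at hlt hno htop
    have := (hl.isCertified le_rfl).card_inter_le hno htop hf.1 hf.2.1
    rw [hf.2.2] at this
    omega
  · have hl := h.isLoopRun_of_lt (not_le.1 hk) hr
    simp only [loopTarget, loopInstance, if_neg hk] at hlt hno htop
    have := (hl.isCertified le_rfl).card_inter_le hno htop hf.dualize.1 hf.dualize.2.1
    rw [hf.dualize.2.2] at this
    omega

/-- Every pair that occurs in a run is optimal for the size of its intersection. -/
lemma IsUnconstrainedOptimal.isOptimal_of_mem_runPairs (h : I.IsUnconstrainedOptimal X₀ Y₀)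
    (hr : I.IsRun k X₀ Y₀ n σ) {p : Finset E × Finset E} (hp : p ∈ runPairs k X₀ Y₀ n σ) :
    I.IsOptimal (p.1 ∩ p.2).card p.1 p.2 := by
  obtain ⟨i, hi, rfl⟩ := hp
  by_cases hk : (X₀ ∩ Y₀).card ≤ k
  · have := ((h.isLoopRun_of_le hk hr).isCertified hi).isOptimal
    simpa only [currentY, if_pos hk] using this
  · have := ((h.isLoopRun_of_lt (not_le.1 hk) hr).isCertified hi).isOptimal.of_dualize
    simp only [currentY, if_neg hk]
    rwa [this.1.2.2]

lemma IsUnconstrainedOptimal.card_eq_of_returns (h : I.IsUnconstrainedOptimal X₀ Y₀)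
    (hr : I.IsRun k X₀ Y₀ n σ) (hret : I.Returns k X₀ Y₀ (σ n)) :
    ((σ n).X ∩ currentY k X₀ Y₀ (σ n)).card = k := by
  unfold Returns at hret
  by_cases hk : (X₀ ∩ Y₀).card ≤ k
  · have := (h.isLoopRun_of_le hk hr).card_le le_rfl
    simp only [loopTarget, currentY, if_pos hk] at hret ⊢
    omega
  · have hl := h.isLoopRun_of_lt (not_le.1 hk) hr
    have h1 := hl.card_le le_rfl
    have h2 := card_inter_compl_add (σ n).X (σ n).Y
    have h3 := card_eq_matroidRank (M := I.M₁) (hl.isCertified le_rfl).isBase₁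
    have h4 := card_inter_compl_add X₀ Y₀
    have h5 := card_eq_matroidRank h.1
    simp only [loopTarget, currentY, if_neg hk] at hret ⊢
    omega

/-- A complete run for `k` above `|X₀ ∩ Y₀|` passes every feasible intersection size between. -/
lemma IsUnconstrainedOptimal.exists_mem_runPairs_of_le (h : I.IsUnconstrainedOptimal X₀ Y₀)
    (hr : I.IsRun k X₀ Y₀ n σ) (hfin : I.Stops k X₀ Y₀ (σ n)) {l : ℕ}
    (hl : (X₀ ∩ Y₀).card ≤ l) (hlk : l ≤ k) {X Y : Finset E} (hf : I.IsFeasible l X Y) :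
    ∃ p ∈ runPairs k X₀ Y₀ n σ, (p.1 ∩ p.2).card = l := by
  have hk := hl.trans hlk
  have hrun := h.isLoopRun_of_le hk hr
  have hn : l ≤ ((σ n).X ∩ (σ n).Y).card := by
    rcases hfin with hret | ⟨-, hno, htop⟩
    · have := h.card_eq_of_returns hr hret
      simp only [currentY, if_pos hk] at this
      omega
    · simp only [loopInstance, if_pos hk] at hno htop
      rw [← hf.2.2]
      exact (hrun.isCertified le_rfl).card_inter_le hno htop hf.1 hf.2.1
  obtain ⟨j, hj, hcard⟩ :=
    hrun.exists_card_eq (by rw [hr.1]; simpa [loopStart, if_pos hk]) le_rfl hn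
  exact ⟨_, ⟨j, hj, rfl⟩, by simpa only [currentY, if_pos hk]⟩

/-- A complete run for `k` below `|X₀ ∩ Y₀|` passes every feasible intersection size between. -/
lemma IsUnconstrainedOptimal.exists_mem_runPairs_of_lt (h : I.IsUnconstrainedOptimal X₀ Y₀)
    (hr : I.IsRun k X₀ Y₀ n σ) (hfin : I.Stops k X₀ Y₀ (σ n)) {l : ℕ}
    (hl : l < (X₀ ∩ Y₀).card) (hkl : k ≤ l) {X Y : Finset E} (hf : I.IsFeasible l X Y) :
    ∃ p ∈ runPairs k X₀ Y₀ n σ, (p.1 ∩ p.2).card = l := by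
  have hk := hkl.trans_lt hl
  have hrun := h.isLoopRun_of_lt hk hr
  have h4 := card_inter_compl_add X₀ Y₀
  have h5 := card_eq_matroidRank h.1
  have hn : matroidRank I.M₁ - l ≤ ((σ n).X ∩ (σ n).Y).card := by
    rcases hfin with hret | ⟨-, hno, htop⟩
    · unfold Returns at hret
      simp only [loopTarget, if_neg hk.not_ge] at hret
      omega
    · simp only [loopInstance, if_neg hk.not_ge] at hno htop
      rw [← hf.dualize.2.2]
      exact (hrun.isCertified le_rfl).card_inter_le hno htop hf.dualize.1 hf.dualize.2.1
  obtain ⟨j, hj, hcard⟩ := hrun.exists_card_eq (by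
    rw [hr.1]
    simp only [loopStart, if_neg hk.not_ge, h.card_inter_compl]
    omega) le_rfl hn
  refine ⟨_, ⟨j, hj, rfl⟩, ?_⟩
  have h2 := card_inter_compl_add (σ j).X (σ j).Y
  have h3 := card_eq_matroidRank (M := I.M₁) (hrun.isCertified hj).isBase₁
  simp only [currentY, if_neg hk.not_ge]
  omega

lemma stops_or_exists_augments (s : PDState E) :
    I.Stops k X₀ Y₀ s ∨ ∃ s', (I.loopInstance k X₀ Y₀).Augments s s' := by
  by_cases hret : I.Returns k X₀ Y₀ s
  · exact Or.inl (Or.inl hret)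
  by_cases hs : (∃ P, (I.loopInstance k X₀ Y₀).IsAugmentingPath s P) ∨
      (I.loopInstance k X₀ Y₀).stepLength s ≠ ⊤
  · exact Or.inr (exists_augments hs)
  · push Not at hs
    exact Or.inl (Or.inr ⟨not_not.1 hret, hs.1, hs.2⟩)

end

end BasisPairInstance

/-! ### Correctness and running time -/

theorem theorem3p5 {E : Type*} [Fintype E] [DecidableEq E] (I : BasisPairInstance E) :
    -- an unconstrained optimal pair, with which the algorithm starts, exists
    (∃ X₀ Y₀ : Finset E, I.IsUnconstrainedOptimal X₀ Y₀) ∧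
    ∀ X₀ Y₀ : Finset E, I.IsUnconstrainedOptimal X₀ Y₀ →
      -- correctness and number of augmentations, for every `k` and every run
      (∀ (k n : ℕ) (σ : ℕ → PDState E), I.IsRun k X₀ Y₀ n σ →
        ((X₀ ∩ Y₀).card ≤ k → n ≤ k * Fintype.card E) ∧
        (k < (X₀ ∩ Y₀).card → n ≤ (matroidRank I.M₁ - k) * Fintype.card E) ∧
        (I.Stops k X₀ Y₀ (σ n) ∨ ∃ s', (I.loopInstance k X₀ Y₀).Augments (σ n) s') ∧
        (I.Returns k X₀ Y₀ (σ n) →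
          I.IsOptimal k (σ n).X (BasisPairInstance.currentY k X₀ Y₀ (σ n))) ∧
        (I.ReportsInfeasible k X₀ Y₀ (σ n) → ¬ ∃ X Y : Finset E, I.IsFeasible k X Y)) ∧
      -- all values of `k` by two complete runs, for `k = 0` and for `k = K`
      (∀ K : ℕ, K = min (matroidRank I.M₁) (matroidRank I.M₂) →
        ∀ (n n' : ℕ) (σ σ' : ℕ → PDState E),
          I.IsRun 0 X₀ Y₀ n σ → I.Stops 0 X₀ Y₀ (σ n) →
          I.IsRun K X₀ Y₀ n' σ' → I.Stops K X₀ Y₀ (σ' n') →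
          n + n' ≤ Fintype.card E ^ 2 ∧
          ∀ V : Set (Finset E × Finset E),
            V = BasisPairInstance.runPairs 0 X₀ Y₀ n σ ∪
              BasisPairInstance.runPairs K X₀ Y₀ n' σ' →
            (∀ p ∈ V, I.IsOptimal (p.1 ∩ p.2).card p.1 p.2) ∧
            ∀ k ≤ K, (∃ X Y : Finset E, I.IsFeasible k X Y) → ∃ p ∈ V, (p.1 ∩ p.2).card = k) := by
  refine ⟨I.exists_isUnconstrainedOptimal, fun X₀ Y₀ h => ⟨fun k n σ hr => ⟨fun hk => ?_,
    fun hk => ?_, BasisPairInstance.stops_or_exists_augments _, fun hret => ?_,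
    fun hinf ⟨X, Y, hf⟩ => BasisPairInstance.not_isFeasible_of_reportsInfeasible h hr hinf hf⟩, ?_⟩⟩
  · exact (h.length_le_of_le hk hr).trans (Nat.mul_le_mul_right _ (Nat.sub_le _ _))
  · refine (h.length_le_of_lt hk hr).trans (Nat.mul_le_mul_right _ (Nat.sub_le_sub_right ?_ _))
    rw [← BasisPairInstance.card_eq_matroidRank h.1]
    exact Finset.card_le_card Finset.inter_subset_left
  · have := h.isOptimal_of_mem_runPairs hr ⟨n, le_rfl, rfl⟩
    rwa [h.card_eq_of_returns hr hret] at this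
  · intro K hK n n' σ σ' hr hs hr' hs'
    have h1 := BasisPairInstance.card_eq_matroidRank h.1
    have h2 := BasisPairInstance.card_eq_matroidRank h.2.1
    have h0K : (X₀ ∩ Y₀).card ≤ K := by
      rw [hK, ← h1, ← h2]
      exact le_min (Finset.card_le_card Finset.inter_subset_left)
        (Finset.card_le_card Finset.inter_subset_right)
    have hKE : K ≤ Fintype.card E := by
      rw [hK, ← h1]
      exact (min_le_left _ _).trans (Finset.card_le_univ _)
    refine ⟨?_, ?_⟩
    · -- the run for `0` lowers the intersection from `|X₀ ∩ Y₀|`, the run for `K` raises it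
      have hn : n ≤ (X₀ ∩ Y₀).card * Fintype.card E := by
        rcases Nat.eq_zero_or_pos (X₀ ∩ Y₀).card with h0 | h0
        · simpa [h0] using h.length_le_of_le (h0.le) hr
        · exact h.length_le_of_lt h0 hr
      calc n + n' ≤ (X₀ ∩ Y₀).card * Fintype.card E +
            (K - (X₀ ∩ Y₀).card) * Fintype.card E := add_le_add hn (h.length_le_of_le h0K hr')
        _ = K * Fintype.card E := by rw [← Nat.add_mul, Nat.add_sub_cancel' h0K]
        _ ≤ Fintype.card E ^ 2 := by rw [sq]; exact Nat.mul_le_mul_right _ hKE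
    · rintro V rfl
      refine ⟨?_, fun k hk ⟨X, Y, hf⟩ => ?_⟩
      · rintro p (hp | hp)
        · exact h.isOptimal_of_mem_runPairs hr hp
        · exact h.isOptimal_of_mem_runPairs hr' hp
      · rcases le_or_gt (X₀ ∩ Y₀).card k with hle | hlt
        · obtain ⟨p, hp, hpk⟩ := h.exists_mem_runPairs_of_le hr' hs' hle hk hf
          exact ⟨p, Or.inr hp, hpk⟩
        · obtain ⟨p, hp, hpk⟩ := h.exists_mem_runPairs_of_lt hr hs hlt (Nat.zero_le k) hf
          exact ⟨p, Or.inl hp, hpk⟩
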